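/- Let $\mathrm{Vir}$ be the complex Virasoro algebra, with basis $\{d_i, c : i\in\mathbb Z\}$, $c$ central and $[d_i,d_j]=(j-i)d_{i+j}+\delta_{i,-j}\frac{i^3-i}{12}c$. Let $n\ge 0$ be an integer, $\mathbf a=(a_n,\dots,a_{2n})\in\mathbb C^{n+1}$, $a_k:=0$ for $k>2n$, and let $\theta,\alpha\in\mathbb C$, $\lambda\in\mathbb C\setminus\{0\}$, $h\in\mathbb C[t]$. For $f\in\mathbb C[t]$ put $F(f)=\frac{h(t)-h(\alpha)}{t-\alpha}f-f'$ and $G(f)=h(\alpha)f+tF(f)$. - $\Omega(\lambda,\alpha,h)$ is the $\mathrm{Vir}$-module $\mathbb C[t,s]$ on which $c$ acts by $0$ and, for $m\in\mathbb Z$, $i\ge 0$, $f\in\mathbb C[t]$, $$d_m\big(f(t)s^i\big)=\lambda^m(s-m)^i\Big(\Big(s+mh(t)-m(m-1)\alpha\tfrac{h(t)-h(\alpha)}{t-\alpha}\Big)f(t)-m(t-m\alpha)f'(t)\Big).$$ - $V_{\mathbf a,\theta}=M/(c-\theta)M$, where $M=U(\mathrm{Vir})\otimes_{U(\mathfrak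 p)}\mathbb C$, $\mathfrak p=\mathrm{span}\{d_i : i\ge n\}$, and $\mathfrak p$ acts on $\mathbb C$ by $d_i\cdot 1=a_i$ for $i\ge n$. (For $n=0$ this is the Verma module with highest weight $a_0$ and central charge $\theta$, for $n\ge1$ it is a Whittaker module.) - $\mathfrak b_{\lambda,n+1}$ is the subalgebra $\mathrm{span}\{d_k-\lambda^{k-n}d_n : k\ge n+1\}$ of $\mathrm{Vir}$, and $\mathbb C[t]_{\alpha,h,\mathbf a}$ is the $\mathfrak b_{\lambda,n+1}$-module $\mathbb C[t]$ with $$(d_k-\lambda^{k-n}d_n)\circ f=(k-n)\lambda^k\big(G(f)-(k+n)\alpha F(f)\big)+(a_k-\lambda^{k-n}a_n)f,\qquad k\ge n+1.$$ - $\mathrm{Ind}_{\theta,\lambda}(\mathbb C[t]_{\alpha,h,\mathbf a})=W/(c-\theta)W$, where $W=U(\mathrm{Vir})\otimes_{U(\mathfrak b_{\lambda,n+1})}\mathbb C[t]_{\alpha,h,\mathbf a}$. **Theorem 5.2.** There is an isomorphism of $\mathrm{Vir}$-modules $$\Omega(\lambda,\alpha,h)\otimes V_{\mathbf a,\theta}\;\cong\;\mathrm{Ind}_{\theta,\lambda}(\mathbb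 C[t]_{\alpha,h,\mathbf a}).$$ In particular this holds when $\alpha\ne0$ and $\deg h=1$. -/

import Mathlib

open Polynomial TensorProduct

noncomputable section

/-! ### The Virasoro algebra -/

/-- The underlying space of the Virasoro algebra: the complex vector space with basis
`d i` (`i : ℤ`) and `c`. -/
def Vir : Type := (ℤ →₀ ℂ) × ℂ

namespace Vir

instance : AddCommGroup Vir := inferInstanceAs (AddCommGroup ((ℤ →₀ ℂ) × ℂ))
instance : Module ℂ Vir := inferInstanceAs (Module ℂ ((ℤ →₀ ℂ) × ℂ))

/-- The basis vector `d i`. -/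
def d (i : ℤ) : Vir := (Finsupp.single i 1, 0)

/-- The basis vector `c`. -/
def c : Vir := (0, 1)

/-- The linear map out of `Vir` sending `d i` to `E i` and `c` to `z`. -/
def lift {M : Type*} [AddCommGroup M] [Module ℂ M] (E : ℤ → M) (z : M) : Vir →ₗ[ℂ] M :=
  LinearMap.coprod (Finsupp.linearCombination ℂ E) (LinearMap.toSpanSingleton ℂ M z)

@[simp] theorem lift_d {M : Type*} [AddCommGroup M] [Module ℂ M] (E : ℤ → M) (z : M) (i : ℤ) :
    lift E z (d i) = E i := by
  change LinearMap.coprod _ _ ((Finsupp.single i 1, 0) : (ℤ →₀ ℂ) × ℂ) = _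
  simp

@[simp] theorem lift_c {M : Type*} [AddCommGroup M] [Module ℂ M] (E : ℤ → M) (z : M) :
    lift E z c = z := by
  change LinearMap.coprod _ _ ((0, 1) : (ℤ →₀ ℂ) × ℂ) = _
  simp

theorem induction {p : Vir → Prop} (hd : ∀ i, p (d i)) (hc : p c)
    (hadd : ∀ x y, p x → p y → p (x + y)) (hsmul : ∀ (r : ℂ) x, p x → p (r • x)) (x : Vir) :
    p x := by
  obtain ⟨f, z⟩ := x
  have h1 : ∀ f : ℤ →₀ ℂ, p ((f, 0) : (ℤ →₀ ℂ) × ℂ) := by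
    intro f
    induction f using Finsupp.induction_linear with
    | zero =>
      have := hsmul 0 c hc
      rwa [zero_smul] at this
    | add f g hf hg =>
      have := hadd _ _ hf hg
      have e : ((f, 0) : (ℤ →₀ ℂ) × ℂ) + (g, 0) = (f + g, 0) := by simp
      exact e ▸ this
    | single i r =>
      have := hsmul r _ (hd i)
      have e : r • ((Finsupp.single i 1, 0) : (ℤ →₀ ℂ) × ℂ) = (Finsupp.single i r, 0) := by simp
      exact e ▸ this
  have h2 := hadd _ _ (h1 f) (hsmul z c hc)
  have e : ((f, 0) : (ℤ →₀ ℂ) × ℂ) + z • ((0, 1) : (ℤ →₀ ℂ) × ℂ) = (f, z) := by simp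
  exact e ▸ h2

/-- The bracket on basis vectors:
`[d i, d j] = (j - i) d (i + j) + δ_{i,-j} (i ^ 3 - i) / 12 c`. -/
def relBracket (i j : ℤ) : Vir :=
  ((j : ℂ) - i) • d (i + j) + (if i = -j then ((i : ℂ) ^ 3 - i) / 12 else 0) • c

/-- The bilinear bracket of the Virasoro algebra, with `c` central. -/
def bracketMap : Vir →ₗ[ℂ] Vir →ₗ[ℂ] Vir :=
  lift (fun i => lift (fun j => relBracket i j) 0) 0

instance : Bracket Vir Vir := ⟨fun x y => bracketMap x y⟩

theorem bracket_def (x y : Vir) : ⁅x, y⁆ = bracketMap x y := rfl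

theorem bracketMap_d_d (i j : ℤ) : bracketMap (d i) (d j) = relBracket i j := by
  simp [bracketMap]

theorem bracketMap_c_left (x : Vir) : bracketMap c x = 0 := by
  simp [bracketMap]

theorem bracketMap_c_right (x : Vir) : bracketMap x c = 0 := by
  induction x using induction with
  | hd i => simp [bracketMap]
  | hc => simp [bracketMap]
  | hadd x y hx hy => simp [hx, hy]
  | hsmul r x hx => simp [hx]

theorem bracketMap_skew (x y : Vir) : bracketMap x y = - bracketMap y x := by
  induction x using induction with
  | hc => simp [bracketMap_c_left, bracketMap_c_right]
  | hadd x y hx hy => simp [hx, hy]; abel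
  | hsmul r x hx => simp [hx]
  | hd i =>
    induction y using induction with
    | hc => simp [bracketMap_c_left, bracketMap_c_right]
    | hadd x y hx hy => simp [hx, hy]; abel
    | hsmul r x hx => simp [hx]
    | hd j =>
      simp only [bracketMap_d_d, relBracket, add_comm j i]
      by_cases h : i = -j
      · have h' : j = -i := by omega
        subst h'
        simp
        module
      · have h' : ¬ j = -i := by omega
        simp only [if_neg h, if_neg h']
        module

theorem bracketMap_jacobi (x y z : Vir) :
    bracketMap x (bracketMap y z) =
      bracketMap (bracketMap x y) z + bracketMap y (bracketMap x z) := by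
  induction x using induction with
  | hc => simp [bracketMap_c_left]
  | hadd x y hx hy => simp [hx, hy]; abel
  | hsmul r x hx => simp [hx]
  | hd i =>
    induction y using induction with
    | hc => simp [bracketMap_c_left, bracketMap_c_right]
    | hadd x y hx hy => simp [hx, hy]; abel
    | hsmul r x hx => simp [hx]
    | hd j =>
      induction z using induction with
      | hc => simp [bracketMap_c_right]
      | hadd x y hx hy => simp [hx, hy]; abel
      | hsmul r x hx => simp [hx]
      | hd k =>
        simp only [bracketMap_d_d, relBracket, map_add, map_smul, LinearMap.add_apply,
          LinearMap.smul_apply, bracketMap_c_left, bracketMap_c_right, smul_zero, add_zero]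
        have e1 : i + j + k = i + (j + k) := by ring
        have e2 : j + (i + k) = i + (j + k) := by ring
        rw [e1, e2]
        by_cases h : i = -(j + k)
        · have h1 : i + j = -k := by omega
          have h2 : j = -(i + k) := by omega
          rw [if_pos h, if_pos h1, if_pos h2]
          subst h
          push_cast
          module
        · have h1 : ¬ i + j = -k := by omega
          have h2 : ¬ j = -(i + k) := by omega
          rw [if_neg h, if_neg h1, if_neg h2]
          push_cast
          module

instance : LieRing Vir where
  add_lie x y z := by simp [bracket_def]
  lie_add x y z := by simp [bracket_def]
  lie_self x := by
    have h := bracketMap_skew x x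
    have h2 : (2 : ℂ) • bracketMap x x = 0 := by
      rw [two_smul]
      nth_rewrite 1 [h]
      simp
    exact (smul_eq_zero.mp h2).resolve_left two_ne_zero
  leibniz_lie x y z := bracketMap_jacobi x y z

instance : LieAlgebra ℂ Vir where
  lie_smul r x y := by simp [bracket_def]

theorem lie_d_d (i j : ℤ) : ⁅d i, d j⁆ =
    ((j : ℂ) - i) • d (i + j) + (if i = -j then ((i : ℂ) ^ 3 - i) / 12 else 0) • c :=
  bracketMap_d_d i j

theorem c_lie (x : Vir) : ⁅c, x⁆ = 0 := bracketMap_c_left x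

/-- Operators satisfying the Virasoro relations with trivial central charge give a
representation. -/
theorem lift_lie {A : Type*} [Ring A] [Algebra ℂ A] (E : ℤ → A)
    (hE : ∀ i j, E i * E j - E j * E i = ((j : ℂ) - i) • E (i + j)) (x y : Vir) :
    lift E 0 ⁅x, y⁆ = lift E 0 x * lift E 0 y - lift E 0 y * lift E 0 x := by
  rw [bracket_def]
  induction x using induction with
  | hc => simp [bracketMap_c_left]
  | hadd x y hx hy => simp [hx, hy, add_mul, mul_add]; abel
  | hsmul r x hx => simp [hx, smul_sub]
  | hd i =>
    induction y using induction with
    | hc => simp [bracketMap_c_right]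
    | hadd x y hx hy => simp [hx, hy, add_mul, mul_add]; abel
    | hsmul r x hx => simp [hx, smul_sub]
    | hd j =>
      rw [bracketMap_d_d, relBracket, map_add, map_smul, map_smul]
      simp [hE]

end Vir

/-- A representation of a Lie algebra as a module over it. -/
@[reducible] def lieRingModuleOfRep {L M : Type*} [LieRing L] [LieAlgebra ℂ L] [AddCommGroup M]
    [Module ℂ M] (ρ : L →ₗ[ℂ] Module.End ℂ M)
    (hρ : ∀ x y, ρ ⁅x, y⁆ = ρ x * ρ y - ρ y * ρ x) : LieRingModule L M where
  bracket x m := ρ x m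
  add_lie x y m := by rw [map_add, LinearMap.add_apply]
  lie_add x m n := map_add _ m n
  leibniz_lie x y m := by
    rw [hρ, LinearMap.sub_apply, Module.End.mul_apply, Module.End.mul_apply, sub_add_cancel]

theorem lieModuleOfRep {L M : Type*} [LieRing L] [LieAlgebra ℂ L] [AddCommGroup M]
    [Module ℂ M] (ρ : L →ₗ[ℂ] Module.End ℂ M)
    (hρ : ∀ x y, ρ ⁅x, y⁆ = ρ x * ρ y - ρ y * ρ x) :
    @LieModule ℂ L M _ _ _ _ _ (lieRingModuleOfRep ρ hρ) := by
  let _ := lieRingModuleOfRep ρ hρ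
  refine ⟨fun r x m => ?_, fun r x m => ?_⟩
  · change ρ (r • x) m = r • ρ x m
    rw [map_smul, LinearMap.smul_apply]
  · exact map_smul (ρ x) r m

/-! ### The modules `Ω(λ, α, h)` -/

/-- The polynomial `(h(t) - h(α)) / (t - α)`. -/
def divDiff (α : ℂ) (h : ℂ[X]) : ℂ[X] := (h - C (h.eval α)) /ₘ (X - C α)

theorem divDiff_spec (α : ℂ) (h : ℂ[X]) : h = (X - C α) * divDiff α h + C (h.eval α) := by
  have h1 := mul_divByMonic_eq_iff_isRoot (p := h - C (h.eval α)) (a := α)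
  have h2 := h1.mpr (by simp [IsRoot])
  rw [divDiff, h2]
  ring

/-- `F(f) = (h(t) - h(α)) / (t - α) * f - f'`. -/
def opF (α : ℂ) (h : ℂ[X]) : ℂ[X] →ₗ[ℂ] ℂ[X] :=
  LinearMap.mulLeft ℂ (divDiff α h) - Polynomial.derivative

/-- `G(f) = h(α) f + t F(f)`. -/
def opG (α : ℂ) (h : ℂ[X]) : ℂ[X] →ₗ[ℂ] ℂ[X] :=
  h.eval α • LinearMap.id + LinearMap.mulLeft ℂ X ∘ₗ opF α h

theorem opF_apply (α : ℂ) (h f : ℂ[X]) : opF α h f = divDiff α h * f - derivative f := by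
  simp [opF]

theorem opG_apply (α : ℂ) (h f : ℂ[X]) : opG α h f = C (h.eval α) * f + X * opF α h f := by
  simp [opG, smul_eq_C_mul]

theorem opG_opF_sub (α : ℂ) (h f : ℂ[X]) :
    opG α h (opF α h f) - opF α h (opG α h f) = opF α h f := by
  simp only [opG_apply, opF_apply, derivative_add, derivative_sub, derivative_mul, derivative_C,
    derivative_X]
  ring

/-- The operator `m G - m² α F` on `ℂ[t]`. -/
def opA (α : ℂ) (h : ℂ[X]) (m : ℤ) : ℂ[X] →ₗ[ℂ] ℂ[X] :=
  (m : ℂ) • opG α h - ((m : ℂ) ^ 2 * α) • opF α h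

theorem opA_apply (α : ℂ) (h f : ℂ[X]) (m : ℤ) :
    opA α h m f = C (m : ℂ) * opG α h f - C ((m : ℂ) ^ 2 * α) * opF α h f := by
  simp [opA, smul_eq_C_mul]

/-- For fixed `i`, the linear map sending `f(t)` to
`λ^m (s - m)^i ((s + m h(t) - m (m - 1) α (h(t) - h(α)) / (t - α)) f(t) - m (t - m α) f'(t))`
in `ℂ[t, s] = ℂ[t][s]` (the outer variable is `s`, the coefficients are polynomials in `t`). -/
def omegaTerm (lam : ℂˣ) (α : ℂ) (h : ℂ[X]) (m : ℤ) (i : ℕ) : ℂ[X] →ₗ[ℂ] ℂ[X][X] where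
  toFun f := ((lam ^ m : ℂˣ) : ℂ) • ((X - C (C (m : ℂ))) ^ i *
    ((X + C (C (m : ℂ) * h - C ((m : ℂ) * (m - 1) * α) * divDiff α h)) * C f
      - C (C (m : ℂ) * (X - C (m * α)) * derivative f)))
  map_add' := by
    intro f g
    rw [← smul_add]
    congr 1
    simp only [map_add, map_mul, mul_add]
    ring
  map_smul' := by
    intro r f
    simp only [RingHom.id_apply]
    rw [smul_comm]
    congr 1
    simp only [derivative_mul, derivative_C, map_mul,
      Polynomial.algebraMap_apply, zero_mul, zero_add, Algebra.smul_def]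
    simp only [Algebra.algebraMap_self, RingHom.id_apply]
    ring

/-- The action of `d m` on `Ω(λ, α, h) = ℂ[t, s]`: the linear operator sending `f(t) s^i` to
`λ^m (s - m)^i ((s + m h(t) - m (m - 1) α (h(t) - h(α)) / (t - α)) f(t) - m (t - m α) f'(t))`. -/
def omegaD (lam : ℂˣ) (α : ℂ) (h : ℂ[X]) (m : ℤ) : Module.End ℂ ℂ[X][X] :=
  Polynomial.lsum (omegaTerm lam α h m)

theorem omegaD_monomial (lam : ℂˣ) (α : ℂ) (h : ℂ[X]) (m : ℤ) (f : ℂ[X]) (i : ℕ) :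
    omegaD lam α h m (C f * X ^ i) = ((lam ^ m : ℂˣ) : ℂ) • ((X - C (C (m : ℂ))) ^ i *
        ((X + C (C (m : ℂ) * h - C ((m : ℂ) * (m - 1) * α) * divDiff α h)) * C f
          - C (C (m : ℂ) * (X - C (m * α)) * derivative f))) := by
  rw [C_mul_X_pow_eq_monomial, omegaD, Polynomial.lsum_apply, Polynomial.sum_monomial_index]
  · rfl
  · exact map_zero _

/-- The action of `d m` in terms of `F` and `G`. -/
theorem omegaD_monomial' (lam : ℂˣ) (α : ℂ) (h : ℂ[X]) (m : ℤ) (f : ℂ[X]) (i : ℕ) :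
    omegaD lam α h m (C f * X ^ i) = ((lam ^ m : ℂˣ) : ℂ) • ((X - C (C (m : ℂ))) ^ i *
        (X * C f + C (opA α h m f))) := by
  rw [omegaD_monomial, opA_apply, opG_apply, opF_apply]
  have e : C (m : ℂ) * h - C ((m : ℂ) * (m - 1) * α) * divDiff α h =
      C (m : ℂ) * ((X - C α) * divDiff α h + C (h.eval α))
        - C ((m : ℂ) * (m - 1) * α) * divDiff α h := by rw [← divDiff_spec]
  rw [e]
  refine congrArg (fun z => ((lam ^ m : ℂˣ) : ℂ) • ((X - C (C (m : ℂ))) ^ i * z)) ?_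
  simp only [map_mul, map_add, map_sub, map_pow, map_one]
  ring

/-- Action on `f(t) q(s)`. -/
theorem omegaD_mul (lam : ℂˣ) (α : ℂ) (h : ℂ[X]) (m : ℤ) (f : ℂ[X]) (q : ℂ[X]) :
    omegaD lam α h m (C f * q.map C) = ((lam ^ m : ℂˣ) : ℂ) •
      ((q.comp (X - C (m : ℂ))).map C * (X * C f + C (opA α h m f))) := by
  induction q using Polynomial.induction_on' with
  | add p q hp hq =>
    rw [Polynomial.map_add, mul_add, map_add, hp, hq, add_comp, Polynomial.map_add, add_mul,
      smul_add]
  | monomial i r =>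
    have e : (C f * (monomial i r).map C : ℂ[X][X]) = r • (C f * X ^ i) := by
      rw [map_monomial, ← C_mul_X_pow_eq_monomial, Algebra.smul_def]
      simp only [Polynomial.algebraMap_apply, Algebra.algebraMap_self, RingHom.id_apply]
      ring
    rw [e, map_smul, omegaD_monomial', smul_comm]
    congr 1
    rw [Algebra.smul_def, monomial_comp]
    simp only [Polynomial.algebraMap_apply, Algebra.algebraMap_self, RingHom.id_apply,
      Polynomial.map_mul, Polynomial.map_pow, Polynomial.map_sub, map_X, map_C]
    ring

theorem omegaD_omegaD (lam : ℂˣ) (α : ℂ) (h : ℂ[X]) (i j : ℤ) (f : ℂ[X]) (k : ℕ) :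
    omegaD lam α h i (omegaD lam α h j (C f * X ^ k)) = ((lam ^ (i + j) : ℂˣ) : ℂ) •
      ((X - C (C (i : ℂ)) - C (C (j : ℂ))) ^ k *
        ((X - C (C (i : ℂ))) * (X * C f + C (opA α h i f))
          + (X * C (opA α h j f) + C (opA α h i (opA α h j f))))) := by
  have e : (X - C (C (j : ℂ))) ^ k * (X * C f + C (opA α h j f)) =
      C f * (((X - C (j : ℂ)) ^ k * X : ℂ[X]).map C)
        + C (opA α h j f) * (((X - C (j : ℂ)) ^ k : ℂ[X]).map C) := by
    simp only [Polynomial.map_mul, Polynomial.map_pow, Polynomial.map_sub, map_X, map_C]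
    ring
  rw [omegaD_monomial', map_smul, e, map_add, omegaD_mul, omegaD_mul, ← smul_add, smul_smul,
    zpow_add, mul_comm (lam ^ i), Units.val_mul]
  congr 1
  simp only [Polynomial.map_mul, Polynomial.map_pow, Polynomial.map_sub, map_X, map_C, mul_comp,
    pow_comp, sub_comp, X_comp, C_comp]
  ring

theorem opA_comm (α : ℂ) (h f : ℂ[X]) (i j : ℤ) :
    opA α h i (opA α h j f) - opA α h j (opA α h i f) =
      C ((i : ℂ) * j * (i - j) * α) * opF α h f := by
  have e := opG_opF_sub α h f
  have e' : opG α h (opF α h f) = opF α h f + opF α h (opG α h f) := 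
    sub_eq_iff_eq_add.mp e
  simp only [opA, LinearMap.sub_apply, LinearMap.smul_apply, map_sub, map_smul, e']
  simp only [smul_eq_C_mul, map_mul, map_pow, map_sub]
  ring

theorem omegaD_comm (lam : ℂˣ) (α : ℂ) (h : ℂ[X]) (i j : ℤ) :
    omegaD lam α h i * omegaD lam α h j - omegaD lam α h j * omegaD lam α h i
      = ((j : ℂ) - i) • omegaD lam α h (i + j) := by
  refine LinearMap.ext fun p => ?_
  induction p using Polynomial.induction_on' with
  | add p q hp hq => rw [map_add, map_add, hp, hq]
  | monomial k f =>
    rw [← C_mul_X_pow_eq_monomial, LinearMap.sub_apply, Module.End.mul_apply,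
      Module.End.mul_apply, LinearMap.smul_apply, omegaD_omegaD, omegaD_omegaD, omegaD_monomial',
      add_comm j i, ← smul_sub, smul_comm]
    congr 1
    have e : opA α h i (opA α h j f) = opA α h j (opA α h i f) +
      C ((i : ℂ) * j * (i - j) * α) * opF α h f := by rw [← opA_comm]; ring
    rw [e, Algebra.smul_def]
    simp only [opA_apply, Polynomial.algebraMap_apply, Algebra.algebraMap_self, RingHom.id_apply,
      map_mul, map_add, map_sub, map_pow, Int.cast_add]
    ring

/-- The space `ℂ[t, s]` carrying the Virasoro module `Ω(λ, α, h)`. -/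
def Omega (_lam : ℂˣ) (_α : ℂ) (_h : ℂ[X]) : Type := ℂ[X][X]

namespace Omega

instance (lam : ℂˣ) (α : ℂ) (h : ℂ[X]) : AddCommGroup (Omega lam α h) :=
  inferInstanceAs (AddCommGroup ℂ[X][X])

instance (lam : ℂˣ) (α : ℂ) (h : ℂ[X]) : Module ℂ (Omega lam α h) :=
  inferInstanceAs (Module ℂ ℂ[X][X])

theorem rep_lie (lam : ℂˣ) (α : ℂ) (h : ℂ[X]) (x y : Vir) :
    Vir.lift (omegaD lam α h) 0 ⁅x, y⁆ =
      Vir.lift (omegaD lam α h) 0 x * Vir.lift (omegaD lam α h) 0 y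
        - Vir.lift (omegaD lam α h) 0 y * Vir.lift (omegaD lam α h) 0 x :=
  Vir.lift_lie (omegaD lam α h) (omegaD_comm lam α h) x y

/-- `d m` acts by `omegaD` and `c` acts by `0`. -/
instance (lam : ℂˣ) (α : ℂ) (h : ℂ[X]) : LieRingModule Vir (Omega lam α h) :=
  lieRingModuleOfRep (M := ℂ[X][X]) (Vir.lift (omegaD lam α h) 0) (rep_lie lam α h)

instance (lam : ℂˣ) (α : ℂ) (h : ℂ[X]) : LieModule ℂ Vir (Omega lam α h) :=
  lieModuleOfRep (M := ℂ[X][X]) (Vir.lift (omegaD lam α h) 0) (rep_lie lam α h)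

theorem d_lie (lam : ℂˣ) (α : ℂ) (h : ℂ[X]) (m : ℤ) (p : Omega lam α h) :
    ⁅Vir.d m, p⁆ = omegaD lam α h m p := by
  change (Vir.lift (omegaD lam α h) 0 (Vir.d m)) p = _
  rw [Vir.lift_d]

theorem c_lie (lam : ℂˣ) (α : ℂ) (h : ℂ[X]) (p : Omega lam α h) : ⁅Vir.c, p⁆ = 0 := by
  change (Vir.lift (omegaD lam α h) 0 Vir.c) p = _
  rw [Vir.lift_c]
  rfl

end Omega

/-! ### Induced modules -/

section Induced

variable {L : Type*} [LieRing L] [LieAlgebra ℂ L] (K : LieSubalgebra ℂ L)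
  (N : Type*) [AddCommGroup N] [Module ℂ N] [LieRingModule K N] [LieModule ℂ K N]

/-- The relations `u x ⊗ v = u ⊗ x v` (`u ∈ U(L)`, `x ∈ K`, `v ∈ N`) defining
`U(L) ⊗_{U(K)} N` as a quotient of `U(L) ⊗_ℂ N`. -/
def indRel : Submodule (UniversalEnvelopingAlgebra ℂ L) (UniversalEnvelopingAlgebra ℂ L ⊗[ℂ] N) :=
  Submodule.span _ {z | ∃ (x : K) (v : N),
    z = UniversalEnvelopingAlgebra.ι ℂ (x : L) ⊗ₜ[ℂ] v - 1 ⊗ₜ[ℂ] ⁅x, v⁆}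

/-- The induced module `U(L) ⊗_{U(K)} N`. -/
def Ind : Type _ := (UniversalEnvelopingAlgebra ℂ L ⊗[ℂ] N) ⧸ indRel K N

instance : AddCommGroup (Ind K N) :=
  inferInstanceAs (AddCommGroup ((UniversalEnvelopingAlgebra ℂ L ⊗[ℂ] N) ⧸ indRel K N))

instance : Module (UniversalEnvelopingAlgebra ℂ L) (Ind K N) :=
  inferInstanceAs (Module (UniversalEnvelopingAlgebra ℂ L)
    ((UniversalEnvelopingAlgebra ℂ L ⊗[ℂ] N) ⧸ indRel K N))

instance : Module ℂ (Ind K N) :=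
  inferInstanceAs (Module ℂ ((UniversalEnvelopingAlgebra ℂ L ⊗[ℂ] N) ⧸ indRel K N))

instance : IsScalarTower ℂ (UniversalEnvelopingAlgebra ℂ L) (Ind K N) :=
  inferInstanceAs (IsScalarTower ℂ (UniversalEnvelopingAlgebra ℂ L)
    ((UniversalEnvelopingAlgebra ℂ L ⊗[ℂ] N) ⧸ indRel K N))

/-- `L` acts on the induced module through `L → U(L)`. -/
instance : LieRingModule L (Ind K N) where
  bracket x m := UniversalEnvelopingAlgebra.ι ℂ x • m
  add_lie x y m := by
    change (UniversalEnvelopingAlgebra.ι ℂ (x + y)) • m = _ • m + _ • m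
    rw [map_add, add_smul]
  lie_add x m n := smul_add _ m n
  leibniz_lie x y m := by
    change _ • _ • m = (UniversalEnvelopingAlgebra.ι ℂ ⁅x, y⁆) • m + _ • _ • m
    let _ : LieRing (UniversalEnvelopingAlgebra ℂ L) := LieRing.ofAssociativeRing
    rw [LieHom.map_lie, LieRing.of_associative_ring_bracket, sub_smul, mul_smul, mul_smul]
    abel

instance : LieModule ℂ L (Ind K N) where
  smul_lie r x m := by
    change (UniversalEnvelopingAlgebra.ι ℂ (r • x)) • m = r • (_ • m)
    rw [map_smul, smul_assoc]
  lie_smul r x m := by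
    change (UniversalEnvelopingAlgebra.ι ℂ x) • (r • m) = r • (_ • m)
    rw [← algebraMap_smul (UniversalEnvelopingAlgebra ℂ L) r m,
      ← algebraMap_smul (UniversalEnvelopingAlgebra ℂ L) r
        (UniversalEnvelopingAlgebra.ι ℂ x • m), smul_smul, smul_smul, Algebra.commutes]

end Induced

/-- The submodule `(c - θ) M` of a Virasoro module `M`. -/
def centralRange (θ : ℂ) (M : Type*) [AddCommGroup M] [Module ℂ M] [LieRingModule Vir M]
    [LieModule ℂ Vir M] : LieSubmodule ℂ Vir M where
  __ := LinearMap.range (LieModule.toEnd ℂ Vir M Vir.c - θ • LinearMap.id)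
  lie_mem := by
    rintro x _ ⟨m, rfl⟩
    refine ⟨⁅x, m⁆, ?_⟩
    have e := leibniz_lie Vir.c x m
    rw [Vir.c_lie, zero_lie, zero_add] at e
    simp [e]

/-- The quotient `M / (c - θ) M`, on which `c` acts as `θ`. -/
abbrev CentralQuotient (θ : ℂ) (M : Type*) [AddCommGroup M] [Module ℂ M] [LieRingModule Vir M]
    [LieModule ℂ Vir M] : Type _ :=
  M ⧸ centralRange θ M

/-! ### The modules `V_{a, θ}` -/

/-- The subalgebra spanned by all `d i` with `i ≥ n`. -/
def virGE (n : ℕ) : LieSubalgebra ℂ Vir where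
  __ := Submodule.span ℂ {x | ∃ i : ℤ, (n : ℤ) ≤ i ∧ x = Vir.d i}
  lie_mem' := by
    intro x y hx hy
    change x ∈ Submodule.span ℂ _ at hx
    change y ∈ Submodule.span ℂ _ at hy
    change ⁅x, y⁆ ∈ Submodule.span ℂ _
    induction hx, hy using Submodule.span_induction₂ with
    | zero_left => simp
    | zero_right => simp
    | add_left x y z _ _ _ h1 h2 => rw [add_lie]; exact add_mem h1 h2
    | add_right x y z _ _ _ h1 h2 => rw [lie_add]; exact add_mem h1 h2
    | smul_left r x y _ _ h1 => rw [smul_lie]; exact Submodule.smul_mem _ _ h1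
    | smul_right r x y _ _ h1 => rw [lie_smul]; exact Submodule.smul_mem _ _ h1
    | mem_mem x y hx hy =>
      obtain ⟨i, hi, rfl⟩ := hx
      obtain ⟨j, hj, rfl⟩ := hy
      rw [Vir.lie_d_d]
      have e : (if i = -j then ((i : ℂ) ^ 3 - i) / 12 else 0) = 0 := by
        split_ifs with h
        · have : i = 0 := by omega
          simp [this]
        · rfl
      rw [e, zero_smul, add_zero]
      exact Submodule.smul_mem _ _ (Submodule.subset_span ⟨i + j, by omega, rfl⟩)

/-- The data `a = (a_n, …, a_{2n})`, indexed so that `a ⟨j, _⟩` is `a_{n + j}`, extended by zero: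
`aExt n a k = a_k` for `n ≤ k ≤ 2 n`, and `0` otherwise. -/
def aExt (n : ℕ) (a : Fin (n + 1) → ℂ) (k : ℤ) : ℂ :=
  if hk : (n : ℤ) ≤ k ∧ k ≤ 2 * n then a ⟨(k - n).toNat, by omega⟩ else 0

theorem aExt_of_gt (n : ℕ) (a : Fin (n + 1) → ℂ) (k : ℤ) (hk : 2 * (n : ℤ) < k) :
    aExt n a k = 0 :=
  dif_neg (by omega)

/-- The functional on `Vir` with `d i ↦ a_i` (zero unless `n ≤ i ≤ 2 n`) and `c ↦ 0`. -/
def whitFun (n : ℕ) (a : Fin (n + 1) → ℂ) : Vir →ₗ[ℂ] ℂ := Vir.lift (aExt n a) 0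

theorem whitFun_lie (n : ℕ) (a : Fin (n + 1) → ℂ) (x y : Vir) (hx : x ∈ virGE n)
    (hy : y ∈ virGE n) : whitFun n a ⁅x, y⁆ = 0 := by
  change x ∈ Submodule.span ℂ _ at hx
  change y ∈ Submodule.span ℂ _ at hy
  induction hx, hy using Submodule.span_induction₂ with
  | zero_left => simp
  | zero_right => simp
  | add_left x y z _ _ _ h1 h2 => rw [add_lie, map_add, h1, h2, add_zero]
  | add_right x y z _ _ _ h1 h2 => rw [lie_add, map_add, h1, h2, add_zero]
  | smul_left r x y _ _ h1 => rw [smul_lie, map_smul, h1, smul_zero]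
  | smul_right r x y _ _ h1 => rw [lie_smul, map_smul, h1, smul_zero]
  | mem_mem x y hx hy =>
    obtain ⟨i, hi, rfl⟩ := hx
    obtain ⟨j, hj, rfl⟩ := hy
    by_cases h : i = j
    · subst h; simp
    · rw [Vir.lie_d_d, whitFun, map_add, map_smul, map_smul, Vir.lift_d, Vir.lift_c,
        aExt_of_gt n a _ (by omega)]
      simp

/-- The one-dimensional module `ℂ` over `span {d i : i ≥ n}`, with `d i · 1 = a_i` for
`n ≤ i ≤ 2 n` and `d i · 1 = 0` for `i > 2 n`. -/
def WhitMod (n : ℕ) (_a : Fin (n + 1) → ℂ) : Type := ℂ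

namespace WhitMod

instance (n : ℕ) (a : Fin (n + 1) → ℂ) : AddCommGroup (WhitMod n a) :=
  inferInstanceAs (AddCommGroup ℂ)

instance (n : ℕ) (a : Fin (n + 1) → ℂ) : Module ℂ (WhitMod n a) :=
  inferInstanceAs (Module ℂ ℂ)

/-- The action of `virGE n` on `ℂ`: multiplication by the value of `whitFun`. -/
def rep (n : ℕ) (a : Fin (n + 1) → ℂ) : virGE n →ₗ[ℂ] Module.End ℂ ℂ :=
  LinearMap.mul ℂ ℂ ∘ₗ whitFun n a ∘ₗ (virGE n).toSubmodule.subtype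

theorem rep_apply (n : ℕ) (a : Fin (n + 1) → ℂ) (x : virGE n) (z : ℂ) :
    rep n a x z = whitFun n a (x : Vir) * z := rfl

theorem rep_lie (n : ℕ) (a : Fin (n + 1) → ℂ) (x y : virGE n) :
    rep n a ⁅x, y⁆ = rep n a x * rep n a y - rep n a y * rep n a x := by
  refine LinearMap.ext fun z => ?_
  simp only [LinearMap.sub_apply, Module.End.mul_apply, rep_apply]
  rw [LieSubalgebra.coe_bracket, whitFun_lie n a _ _ x.2 y.2]
  ring

instance (n : ℕ) (a : Fin (n + 1) → ℂ) : LieRingModule (virGE n) (WhitMod n a) :=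
  lieRingModuleOfRep (M := ℂ) (rep n a) (rep_lie n a)

instance (n : ℕ) (a : Fin (n + 1) → ℂ) : LieModule ℂ (virGE n) (WhitMod n a) :=
  lieModuleOfRep (M := ℂ) (rep n a) (rep_lie n a)

end WhitMod

/-- `V_{a, θ}`: the Verma module with highest weight `a_0` and central charge `θ` for `n = 0`, and
a Whittaker module for `n ≥ 1`. -/
abbrev WhittakerVerma (n : ℕ) (a : Fin (n + 1) → ℂ) (θ : ℂ) : Type :=
  CentralQuotient θ (Ind (virGE n) (WhitMod n a))

/-! ### The subalgebra `b_{λ, n + 1}` and its modules on `ℂ[t]` -/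

/-- The element `d k - λ^(k - n) d n`. -/
def bGen (lam : ℂˣ) (n : ℕ) (k : ℤ) : Vir :=
  Vir.d k - ((lam ^ (k - n) : ℂˣ) : ℂ) • Vir.d n

theorem bGen_lie (lam : ℂˣ) (n : ℕ) (k l : ℤ) (hk : (n : ℤ) < k) (hl : (n : ℤ) < l) :
    ⁅bGen lam n k, bGen lam n l⁆ = ((l : ℂ) - k) • bGen lam n (k + l)
      - (((lam ^ (l - n) : ℂˣ) : ℂ) * (n - k)) • bGen lam n (k + n)
      - (((lam ^ (k - n) : ℂˣ) : ℂ) * (l - n)) • bGen lam n (n + l) := by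
  have e1 : ¬ k = -l := by omega
  have e2 : ¬ k = -(n : ℤ) := by omega
  have e3 : ¬ (n : ℤ) = -l := by omega
  simp only [bGen, sub_lie, lie_sub, smul_lie, lie_smul, lie_self, Vir.lie_d_d, if_neg e1,
    if_neg e2, if_neg e3, zero_smul, add_zero, smul_zero, sub_zero]
  have hl0 : (lam : ℂ) ≠ 0 := lam.ne_zero
  have z1 : ((lam ^ (k + l - n) : ℂˣ) : ℂ) =
      ((lam ^ (k - n) : ℂˣ) : ℂ) * ((lam ^ (l - n) : ℂˣ) : ℂ) * ((lam ^ (n : ℤ) : ℂˣ) : ℂ) := by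
    rw [← Units.val_mul, ← Units.val_mul, ← zpow_add, ← zpow_add]; congr 2; ring
  have z2 : ((lam ^ (k + n - n) : ℂˣ) : ℂ) =
      ((lam ^ (k - n) : ℂˣ) : ℂ) * ((lam ^ (n : ℤ) : ℂˣ) : ℂ) := by
    rw [← Units.val_mul, ← zpow_add]; congr 2; ring
  have z3 : ((lam ^ (n + l - n) : ℂˣ) : ℂ) =
      ((lam ^ (l - n) : ℂˣ) : ℂ) * ((lam ^ (n : ℤ) : ℂˣ) : ℂ) := by
    rw [← Units.val_mul, ← zpow_add]; congr 2; ring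
  rw [z1, z2, z3]
  push_cast
  module

/-- The subalgebra `b_{λ, n + 1} = span {d k - λ^(k - n) d n : k ≥ n + 1}` of `Vir`. -/
def bSub (lam : ℂˣ) (n : ℕ) : LieSubalgebra ℂ Vir where
  __ := Submodule.span ℂ {x | ∃ k : ℤ, (n : ℤ) + 1 ≤ k ∧ x = bGen lam n k}
  lie_mem' := by
    intro x y hx hy
    change x ∈ Submodule.span ℂ _ at hx
    change y ∈ Submodule.span ℂ _ at hy
    change ⁅x, y⁆ ∈ Submodule.span ℂ _
    induction hx, hy using Submodule.span_induction₂ with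
    | zero_left => simp
    | zero_right => simp
    | add_left x y z _ _ _ h1 h2 => rw [add_lie]; exact add_mem h1 h2
    | add_right x y z _ _ _ h1 h2 => rw [lie_add]; exact add_mem h1 h2
    | smul_left r x y _ _ h1 => rw [smul_lie]; exact Submodule.smul_mem _ _ h1
    | smul_right r x y _ _ h1 => rw [lie_smul]; exact Submodule.smul_mem _ _ h1
    | mem_mem x y hx hy =>
      obtain ⟨k, hk, rfl⟩ := hx
      obtain ⟨l, hl, rfl⟩ := hy
      rw [bGen_lie lam n k l (by omega) (by omega)]
      refine sub_mem (sub_mem ?_ ?_) ?_ <;> refine Submodule.smul_mem _ _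
        (Submodule.subset_span ⟨_, ?_, rfl⟩) <;> omega

theorem bGen_mem (lam : ℂˣ) (n : ℕ) (k : ℤ) (hk : (n : ℤ) + 1 ≤ k) : bGen lam n k ∈ bSub lam n :=
  Submodule.subset_span ⟨k, hk, rfl⟩

/-- The linear map `Vir → End ℂ[t]` sending `d k` to `λ^k (k G - k² α F) + a_k` and `c` to `0`.
Its restriction to `b_{λ, n + 1}` is the action on `ℂ[t]_{α, h, a}`; see `bFun_bGen` for its values
on the generators of `b_{λ, n + 1}`. -/
def bFun (lam : ℂˣ) (n : ℕ) (α : ℂ) (h : ℂ[X]) (a : Fin (n + 1) → ℂ) :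
    Vir →ₗ[ℂ] Module.End ℂ ℂ[X] :=
  Vir.lift (fun k => ((lam ^ k : ℂˣ) : ℂ) • opA α h k + aExt n a k • LinearMap.id) 0

/-- `(d k - λ^(k - n) d n) ∘ f =
(k - n) λ^k (G(f) - (k + n) α F(f)) + (a_k - λ^(k - n) a_n) f`. -/
theorem bFun_bGen (lam : ℂˣ) (n : ℕ) (α : ℂ) (h : ℂ[X]) (a : Fin (n + 1) → ℂ) (k : ℤ)
    (f : ℂ[X]) : bFun lam n α h a (bGen lam n k) f =
      (((k : ℂ) - n) * ((lam ^ k : ℂˣ) : ℂ)) • (opG α h f - (((k : ℂ) + n) * α) • opF α h f)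
        + (aExt n a k - ((lam ^ (k - n) : ℂˣ) : ℂ) * aExt n a n) • f := by
  have z : ((lam ^ k : ℂˣ) : ℂ) =
      ((lam ^ (k - n) : ℂˣ) : ℂ) * ((lam ^ (n : ℤ) : ℂˣ) : ℂ) := by
    rw [← Units.val_mul, ← zpow_add]; congr 2; ring
  simp only [bFun, bGen, map_sub, map_smul, Vir.lift_d, opA, LinearMap.sub_apply,
    LinearMap.add_apply, LinearMap.smul_apply, LinearMap.id_apply, z]
  push_cast
  module

theorem bFun_lie (lam : ℂˣ) (n : ℕ) (α : ℂ) (h : ℂ[X]) (a : Fin (n + 1) → ℂ) (x y : Vir)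
    (hx : x ∈ bSub lam n) (hy : y ∈ bSub lam n) :
    bFun lam n α h a ⁅x, y⁆ = bFun lam n α h a x * bFun lam n α h a y
      - bFun lam n α h a y * bFun lam n α h a x := by
  change x ∈ Submodule.span ℂ _ at hx
  change y ∈ Submodule.span ℂ _ at hy
  induction hx, hy using Submodule.span_induction₂ with
  | zero_left => simp
  | zero_right => simp
  | add_left x y z _ _ _ h1 h2 => rw [add_lie, map_add, h1, h2, map_add, add_mul, mul_add]; abel
  | add_right x y z _ _ _ h1 h2 => rw [lie_add, map_add, h1, h2, map_add, add_mul, mul_add]; abel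
  | smul_left r x y _ _ h1 =>
    rw [smul_lie, map_smul, h1, map_smul, smul_mul_assoc, mul_smul_comm, smul_sub]
  | smul_right r x y _ _ h1 =>
    rw [lie_smul, map_smul, h1, map_smul, smul_mul_assoc, mul_smul_comm, smul_sub]
  | mem_mem x y hx hy =>
    obtain ⟨k, hk, rfl⟩ := hx
    obtain ⟨l, hl, rfl⟩ := hy
    refine LinearMap.ext fun f => ?_
    have e := opG_opF_sub α h f
    have e' : opG α h (opF α h f) = opF α h f + opF α h (opG α h f) := 
      sub_eq_iff_eq_add.mp e
    have z1 : ((lam ^ (k + l) : ℂˣ) : ℂ) = ((lam ^ (k - n) : ℂˣ) : ℂ) *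
        ((lam ^ (l - n) : ℂˣ) : ℂ) * ((lam ^ (n : ℤ) : ℂˣ) : ℂ) * ((lam ^ (n : ℤ) : ℂˣ) : ℂ) := by
      simp only [← Units.val_mul, ← zpow_add]; congr 2; ring
    have z2 : ((lam ^ (k + n) : ℂˣ) : ℂ) = ((lam ^ (k - n) : ℂˣ) : ℂ) *
        ((lam ^ (n : ℤ) : ℂˣ) : ℂ) * ((lam ^ (n : ℤ) : ℂˣ) : ℂ) := by
      simp only [← Units.val_mul, ← zpow_add]; congr 2; ring
    have z3 : ((lam ^ (n + l) : ℂˣ) : ℂ) = ((lam ^ (l - n) : ℂˣ) : ℂ) *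
        ((lam ^ (n : ℤ) : ℂˣ) : ℂ) * ((lam ^ (n : ℤ) : ℂˣ) : ℂ) := by
      simp only [← Units.val_mul, ← zpow_add]; congr 2; ring
    have z4 : ((lam ^ (k + l - n) : ℂˣ) : ℂ) =
        ((lam ^ (k - n) : ℂˣ) : ℂ) * ((lam ^ (l - n) : ℂˣ) : ℂ) * ((lam ^ (n : ℤ) : ℂˣ) : ℂ) := by
      simp only [← Units.val_mul, ← zpow_add]; congr 2; ring
    have z5 : ((lam ^ (k + n - n) : ℂˣ) : ℂ) =
        ((lam ^ (k - n) : ℂˣ) : ℂ) * ((lam ^ (n : ℤ) : ℂˣ) : ℂ) := by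
      simp only [← Units.val_mul, ← zpow_add]; congr 2; ring
    have z6 : ((lam ^ (n + l - n) : ℂˣ) : ℂ) =
        ((lam ^ (l - n) : ℂˣ) : ℂ) * ((lam ^ (n : ℤ) : ℂˣ) : ℂ) := by
      simp only [← Units.val_mul, ← zpow_add]; congr 2; ring
    have z7 : ((lam ^ k : ℂˣ) : ℂ) =
        ((lam ^ (k - n) : ℂˣ) : ℂ) * ((lam ^ (n : ℤ) : ℂˣ) : ℂ) := by
      simp only [← Units.val_mul, ← zpow_add]; congr 2; ring
    have z8 : ((lam ^ l : ℂˣ) : ℂ) =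
        ((lam ^ (l - n) : ℂˣ) : ℂ) * ((lam ^ (n : ℤ) : ℂˣ) : ℂ) := by
      simp only [← Units.val_mul, ← zpow_add]; congr 2; ring
    rw [bGen_lie lam n k l (by omega) (by omega)]
    simp only [map_sub, map_smul, LinearMap.sub_apply, LinearMap.smul_apply,
      Module.End.mul_apply, bFun_bGen, map_add]
    rw [aExt_of_gt n a (k + l) (by omega), aExt_of_gt n a (k + n) (by omega),
      aExt_of_gt n a (n + l) (by omega), e', z1, z2, z3, z4, z5, z6, z7, z8]
    push_cast
    module

/-- The space `ℂ[t]` carrying the `b_{λ, n + 1}`-module `ℂ[t]_{α, h, a}`. -/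
def BMod (_lam : ℂˣ) (n : ℕ) (_α : ℂ) (_h : ℂ[X]) (_a : Fin (n + 1) → ℂ) : Type := ℂ[X]

namespace BMod

instance (lam : ℂˣ) (n : ℕ) (α : ℂ) (h : ℂ[X]) (a : Fin (n + 1) → ℂ) :
    AddCommGroup (BMod lam n α h a) :=
  inferInstanceAs (AddCommGroup ℂ[X])

instance (lam : ℂˣ) (n : ℕ) (α : ℂ) (h : ℂ[X]) (a : Fin (n + 1) → ℂ) :
    Module ℂ (BMod lam n α h a) :=
  inferInstanceAs (Module ℂ ℂ[X])

/-- The action of `b_{λ, n + 1}` on `ℂ[t]`. -/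
def rep (lam : ℂˣ) (n : ℕ) (α : ℂ) (h : ℂ[X]) (a : Fin (n + 1) → ℂ) :
    bSub lam n →ₗ[ℂ] Module.End ℂ ℂ[X] :=
  bFun lam n α h a ∘ₗ (bSub lam n).toSubmodule.subtype

theorem rep_lie (lam : ℂˣ) (n : ℕ) (α : ℂ) (h : ℂ[X]) (a : Fin (n + 1) → ℂ)
    (x y : bSub lam n) : rep lam n α h a ⁅x, y⁆ =
      rep lam n α h a x * rep lam n α h a y - rep lam n α h a y * rep lam n α h a x :=
  bFun_lie lam n α h a x y x.2 y.2

instance (lam : ℂˣ) (n : ℕ) (α : ℂ) (h : ℂ[X]) (a : Fin (n + 1) → ℂ) :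
    LieRingModule (bSub lam n) (BMod lam n α h a) :=
  lieRingModuleOfRep (M := ℂ[X]) (rep lam n α h a) (rep_lie lam n α h a)

instance (lam : ℂˣ) (n : ℕ) (α : ℂ) (h : ℂ[X]) (a : Fin (n + 1) → ℂ) :
    LieModule ℂ (bSub lam n) (BMod lam n α h a) :=
  lieModuleOfRep (M := ℂ[X]) (rep lam n α h a) (rep_lie lam n α h a)

theorem bGen_lie (lam : ℂˣ) (n : ℕ) (α : ℂ) (h : ℂ[X]) (a : Fin (n + 1) → ℂ) (k : ℤ)
    (hk : (n : ℤ) + 1 ≤ k) (f : BMod lam n α h a) :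
    ⁅(⟨bGen lam n k, bGen_mem lam n k hk⟩ : bSub lam n), f⁆ =
      bFun lam n α h a (bGen lam n k) f := rfl

end BMod

/-- `Ind_{θ, λ}(ℂ[t]_{α, h, a})`: the Virasoro module induced from `ℂ[t]_{α, h, a}`, with central
charge `θ`. -/
abbrev IndTheta (θ : ℂ) (lam : ℂˣ) (n : ℕ) (α : ℂ) (h : ℂ[X]) (a : Fin (n + 1) → ℂ) : Type :=
  CentralQuotient θ (Ind (bSub lam n) (BMod lam n α h a))

end

/-! Write A_m = m G - m² α F. On f in ℂ[t] the operator d_m of Ω is λ^m (s f + A_m f), so in d_k -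
λ^(k-n) d_n the terms containing s cancel and ℂ[t] is preserved. Let w be the canonical generator of
V, with d_k w = a_k w for k ≥ n. By the Leibniz rule ℂ[t] ⊗ w is then stable under b, and the action
there is exactly that of ℂ[t]_{α,h,a} (`tmulGen_C_bFun`). Since c acts by θ on Ω ⊗ V, the universal
property of induction gives a homomorphism Ind → Ω ⊗ V (`fromInd`).

For the inverse, tensor-hom adjunction together with the universal property of V turns a
homomorphism Ω ⊗ V → Ind into a linear map Φ : Ω → Ind with Φ(d_k p) = (d_k - a_k) Φ(p) for all k ≥
n. The case k = n leaves no choice once Φ is known on ℂ[t], and it can be solved because Ω is free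
over ℂ[d_n] on ℂ[t] (`iterSum_omegaD_bijective`): d_n raises the s-degree by one and multiplies the
leading coefficient by λ^n. Setting Φ(d_n^i f) = (d_n - a_n)^i (1 ⊗ f) defines `omegaTo`. For k > n
the relation holds on ℂ[t] by the defining relations of Ind, and passes to d_n^i f by commuting d_k
past d_n, which works because a_(k+n) = 0 (`omegaTo_omegaD_of_le`).

The two homomorphisms are mutually inverse because both composites fix generators. No PBW basis is
needed. -/

noncomputable section

/-! ### Universal property of induced modules -/

section UniversalProperty

variable {L : Type*} [LieRing L] [LieAlgebra ℂ L]

/-- The universal enveloping algebra is generated by the Lie algebra. -/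
theorem UniversalEnvelopingAlgebra.subalgebra_eq_top
    (S : Subalgebra ℂ (UniversalEnvelopingAlgebra ℂ L))
    (hS : ∀ x : L, UniversalEnvelopingAlgebra.ι ℂ x ∈ S) (u : UniversalEnvelopingAlgebra ℂ L) :
    u ∈ S := by
  let _ : LieRing (UniversalEnvelopingAlgebra ℂ L) := LieRing.ofAssociativeRing
  let _ : LieRing S := LieRing.ofAssociativeRing
  let f : L →ₗ⁅ℂ⁆ S :=
    { toFun := fun x => ⟨UniversalEnvelopingAlgebra.ι ℂ x, hS x⟩
      map_add' := fun x y => Subtype.ext (map_add _ x y)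
      map_smul' := fun r x => Subtype.ext (map_smul _ r x)
      map_lie' := fun {x y} => Subtype.ext (LieHom.map_lie _ x y) }
  -- The composite U(L) → S → U(L) fixes L, hence is the identity, so every u is the image of an
  -- element of S.
  have e : S.val.comp (UniversalEnvelopingAlgebra.lift ℂ f) =
      AlgHom.id ℂ (UniversalEnvelopingAlgebra ℂ L) := by
    refine UniversalEnvelopingAlgebra.hom_ext _ (LieHom.ext fun x => ?_)
    exact congrArg Subtype.val (UniversalEnvelopingAlgebra.lift_ι_apply ℂ f x)
  have e' : (UniversalEnvelopingAlgebra.lift ℂ f u : UniversalEnvelopingAlgebra ℂ L) = u :=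
    congrArg (fun F => F u) e
  exact e' ▸ (UniversalEnvelopingAlgebra.lift ℂ f u).2

variable {M : Type*} [AddCommGroup M] [Module ℂ M] [LieRingModule L M] [LieModule ℂ L M]

variable (L M) in
/-- The action of the universal enveloping algebra on a Lie module. -/
def envAct : UniversalEnvelopingAlgebra ℂ L →ₐ[ℂ] Module.End ℂ M :=
  UniversalEnvelopingAlgebra.lift ℂ (LieModule.toEnd ℂ L M)

theorem envAct_ι (x : L) (m : M) :
    envAct L M (UniversalEnvelopingAlgebra.ι ℂ x) m = ⁅x, m⁆ := by
  rw [envAct, UniversalEnvelopingAlgebra.lift_ι_apply]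
  rfl

namespace Ind

variable (K : LieSubalgebra ℂ L) (N : Type*) [AddCommGroup N] [Module ℂ N] [LieRingModule K N]

/-- The canonical map `v ↦ 1 ⊗ v` from `N` to the induced module. -/
def of : N →ₗ[ℂ] Ind K N :=
  ((indRel K N).mkQ.restrictScalars ℂ) ∘ₗ TensorProduct.mk ℂ (UniversalEnvelopingAlgebra ℂ L) N 1

theorem lie_def (x : L) (m : Ind K N) : ⁅x, m⁆ = UniversalEnvelopingAlgebra.ι ℂ x • m := rfl

variable {N}

theorem of_lie (x : K) (v : N) : of K N ⁅x, v⁆ = ⁅(x : L), of K N v⁆ := by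
  symm
  refine (Submodule.Quotient.eq (indRel K N)
    (x := UniversalEnvelopingAlgebra.ι ℂ (x : L) • ((1 : UniversalEnvelopingAlgebra ℂ L) ⊗ₜ[ℂ] v))
    (y := 1 ⊗ₜ[ℂ] ⁅x, v⁆)).mpr ?_
  rw [TensorProduct.smul_tmul', smul_eq_mul, mul_one]
  exact Submodule.subset_span ⟨x, v, rfl⟩

variable {K}

/-- The elements u that commute with `F` form a subalgebra of U(L) containing L. -/
theorem map_smul_env (F : Ind K N →ₗ⁅ℂ, L⁆ M) (u : UniversalEnvelopingAlgebra ℂ L)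
    (m : Ind K N) : F (u • m) = envAct L M u (F m) := by
  let S : Subalgebra ℂ (UniversalEnvelopingAlgebra ℂ L) :=
    { carrier := {u | ∀ m : Ind K N, F (u • m) = envAct L M u (F m)}
      mul_mem' := fun {u v} hu hv m => by
        rw [mul_smul, hu, hv, map_mul, Module.End.mul_apply]
      add_mem' := fun {u v} hu hv m => by
        rw [add_smul, map_add, hu, hv, map_add, LinearMap.add_apply]
      algebraMap_mem' := fun r m => by
        rw [algebraMap_smul, map_smul, AlgHom.commutes, Module.algebraMap_end_apply] }
  refine UniversalEnvelopingAlgebra.subalgebra_eq_top S (fun x m => ?_) u m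
  rw [envAct_ι, ← LieModuleHom.map_lie, lie_def]

/-- The image of N generates the induced module over U(L), since u ⊗ v = u · (1 ⊗ v). -/
theorem hom_ext {F G : Ind K N →ₗ⁅ℂ, L⁆ M} (h : ∀ v, F (of K N v) = G (of K N v)) : F = G := by
  refine LieModuleHom.ext fun m => ?_
  obtain ⟨z, rfl⟩ := Submodule.Quotient.mk_surjective _ m
  change F ((indRel K N).mkQ z) = G ((indRel K N).mkQ z)
  induction z with
  | zero => rw [map_zero]; exact (map_zero F).trans (map_zero G).symm
  | add x y hx hy =>
    rw [map_add]
    exact (map_add F _ _).trans ((congrArg₂ _ hx hy).trans (map_add G _ _).symm)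
  | tmul u v =>
    have e : (indRel K N).mkQ (u ⊗ₜ v) = u • of K N v := by
      change _ = (indRel K N).mkQ (u • ((1 : UniversalEnvelopingAlgebra ℂ L) ⊗ₜ[ℂ] v))
      rw [TensorProduct.smul_tmul', smul_eq_mul, mul_one]
    rw [e]
    exact (map_smul_env F u _).trans ((congrArg _ (h v)).trans (map_smul_env G u _).symm)

/-- The linear map `u ⊗ v ↦ u · g v`. -/
def preLift (g : N →ₗ[ℂ] M) : UniversalEnvelopingAlgebra ℂ L ⊗[ℂ] N →ₗ[ℂ] M :=
  TensorProduct.lift ((LinearMap.lcomp ℂ M g) ∘ₗ (envAct L M).toLinearMap)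

theorem preLift_tmul (g : N →ₗ[ℂ] M) (u : UniversalEnvelopingAlgebra ℂ L) (v : N) :
    preLift g (u ⊗ₜ v) = envAct L M u (g v) := rfl

theorem preLift_smul (g : N →ₗ[ℂ] M) (u : UniversalEnvelopingAlgebra ℂ L)
    (z : UniversalEnvelopingAlgebra ℂ L ⊗[ℂ] N) :
    preLift g (u • z) = envAct L M u (preLift g z) := by
  induction z with
  | zero => simp
  | add x y hx hy => rw [smul_add, map_add, hx, hy, map_add, map_add]
  | tmul w v =>
    rw [TensorProduct.smul_tmul', preLift_tmul, preLift_tmul, smul_eq_mul, map_mul,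
      Module.End.mul_apply]

/-- As `preLift` is U(L)-linear, it suffices to kill the generators of `indRel`, where vanishing is
the K-equivariance of `g`. -/
theorem preLift_eq_zero (g : N →ₗ[ℂ] M) (hg : ∀ (x : K) (v : N), g ⁅x, v⁆ = ⁅(x : L), g v⁆)
    (z : UniversalEnvelopingAlgebra ℂ L ⊗[ℂ] N) (hz : z ∈ indRel K N) : preLift g z = 0 := by
  induction hz using Submodule.span_induction with
  | mem z hz =>
    obtain ⟨x, v, rfl⟩ := hz
    rw [map_sub, preLift_tmul, preLift_tmul, envAct_ι, map_one, Module.End.one_apply, hg, sub_self]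
  | zero => exact map_zero _
  | add x y _ _ hx hy => rw [map_add, hx, hy, add_zero]
  | smul u z _ hz => rw [preLift_smul, hz, map_zero]

/-- The universal property of the induced module. -/
def lift (g : N →ₗ[ℂ] M) (hg : ∀ (x : K) (v : N), g ⁅x, v⁆ = ⁅(x : L), g v⁆) :
    Ind K N →ₗ⁅ℂ, L⁆ M where
  __ := ((indRel K N).restrictScalars ℂ).liftQ (preLift g) (preLift_eq_zero g hg)
  map_lie' := by
    intro x m
    obtain ⟨z, rfl⟩ := Submodule.Quotient.mk_surjective _ m
    exact (preLift_smul g (UniversalEnvelopingAlgebra.ι ℂ x) z).trans (envAct_ι x _)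

theorem lift_of (g : N →ₗ[ℂ] M) (hg : ∀ (x : K) (v : N), g ⁅x, v⁆ = ⁅(x : L), g v⁆) (v : N) :
    lift g hg (of K N v) = g v := by
  change envAct L M 1 (g v) = g v
  rw [map_one, Module.End.one_apply]

end Ind

end UniversalProperty

/-! ### Fixing the central charge -/

namespace CentralQuotient

variable {θ : ℂ} {M P : Type*} [AddCommGroup M] [Module ℂ M] [LieRingModule Vir M]
  [LieModule ℂ Vir M] [AddCommGroup P] [Module ℂ P] [LieRingModule Vir P] [LieModule ℂ Vir P]

theorem c_lie (m : CentralQuotient θ M) : ⁅Vir.c, m⁆ = θ • m := by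
  obtain ⟨m, rfl⟩ := LieSubmodule.Quotient.surjective_mk' _ m
  rw [← LieModuleHom.map_lie, ← map_smul, ← sub_eq_zero, ← map_sub,
    LieSubmodule.Quotient.mk_eq_zero]
  exact ⟨m, rfl⟩

/-- A homomorphism into a module of central charge `θ` factors through `M / (c - θ) M`. -/
def lift (F : M →ₗ⁅ℂ, Vir⁆ P) (hP : ∀ p : P, ⁅Vir.c, p⁆ = θ • p) :
    CentralQuotient θ M →ₗ⁅ℂ, Vir⁆ P where
  __ := (centralRange θ M).toSubmodule.liftQ (F : M →ₗ[ℂ] P) (by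
    rintro _ ⟨m, rfl⟩
    change F (⁅Vir.c, m⁆ - θ • m) = 0
    rw [map_sub, LieModuleHom.map_lie, map_smul, hP, sub_self])
  map_lie' := by
    intro x m
    obtain ⟨m, rfl⟩ := LieSubmodule.Quotient.surjective_mk' _ m
    exact F.map_lie x m

omit [LieModule ℂ Vir P] in
variable (θ) in
theorem hom_ext {F G : CentralQuotient θ M →ₗ⁅ℂ, Vir⁆ P}
    (h : F.comp (LieSubmodule.Quotient.mk' _) = G.comp (LieSubmodule.Quotient.mk' _)) : F = G := by
  refine LieModuleHom.ext fun m => ?_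
  obtain ⟨m, rfl⟩ := LieSubmodule.Quotient.surjective_mk' _ m
  exact congrArg (fun F => F m) h

variable (θ) (K : LieSubalgebra ℂ Vir) (N : Type*) [AddCommGroup N] [Module ℂ N]
  [LieRingModule K N]

/-- The canonical map from `N` to the induced module of central charge `θ`. -/
def of : N →ₗ[ℂ] CentralQuotient θ (Ind K N) :=
  (LieSubmodule.Quotient.mk' (centralRange θ (Ind K N)) : Ind K N →ₗ[ℂ] _) ∘ₗ Ind.of K N

variable {N}

theorem of_lie (x : K) (v : N) : of θ K N ⁅x, v⁆ = ⁅(x : Vir), of θ K N v⁆ := by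
  change LieSubmodule.Quotient.mk' _ (Ind.of K N ⁅x, v⁆) = _
  rw [Ind.of_lie, LieModuleHom.map_lie]
  rfl

variable {θ K}

theorem indHom_ext {F G : CentralQuotient θ (Ind K N) →ₗ⁅ℂ, Vir⁆ P}
    (h : ∀ v, F (of θ K N v) = G (of θ K N v)) : F = G :=
  hom_ext θ (Ind.hom_ext h)

/-- The universal property of the induced module of central charge `θ`. -/
def indLift (g : N →ₗ[ℂ] P) (hg : ∀ (x : K) (v : N), g ⁅x, v⁆ = ⁅(x : Vir), g v⁆)
    (hP : ∀ p : P, ⁅Vir.c, p⁆ = θ • p) : CentralQuotient θ (Ind K N) →ₗ⁅ℂ, Vir⁆ P :=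
  lift (Ind.lift g hg) hP

theorem indLift_of (g : N →ₗ[ℂ] P) (hg : ∀ (x : K) (v : N), g ⁅x, v⁆ = ⁅(x : Vir), g v⁆)
    (hP : ∀ p : P, ⁅Vir.c, p⁆ = θ • p) (v : N) : indLift g hg hP (of θ K N v) = g v :=
  Ind.lift_of g hg v

end CentralQuotient

/-! ### Triangular operators on polynomials -/

section Triangular

variable {R : Type*} [Ring R] [Module ℂ R]

/-- The hypothesis on `T` says that it raises degree by at most `r` and scales the top coefficient
in degree i by `u i`, so lower monomials cannot reach degree `k + r`. The shift is `r = 1` for one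
application of d_m and `r = 0` for bijectivity. -/
theorem coeff_map_of_triangular {T : R[X] →ₗ[ℂ] R[X]} {u : ℕ → ℂ} {r : ℕ}
    (hT : ∀ (i k : ℕ) (f : R), i ≤ k →
      (T (monomial i f)).coeff (k + r) = if k = i then u i • f else 0)
    (p : R[X]) (k : ℕ) (hp : ∀ j, k < j → p.coeff j = 0) :
    (T p).coeff (k + r) = u k • p.coeff k := by
  have hd : p.natDegree < k + 1 := Nat.lt_succ_iff.mpr (natDegree_le_iff_coeff_eq_zero.mpr hp)
  conv_lhs => rw [p.as_sum_range' (k + 1) hd]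
  rw [map_sum, finsetSum_coeff, Finset.sum_eq_single k]
  · rw [hT k k _ le_rfl, if_pos rfl]
  · intro j hj hjk
    rw [hT j k _ (Nat.lt_succ_iff.mp (Finset.mem_range.mp hj)), if_neg (Ne.symm hjk)]
  · intro hk
    exact absurd (Finset.mem_range.mpr k.lt_succ_self) hk

/-- `T` preserves the degree filtration and acts on its graded pieces by the invertible scalars `u
i`. -/
theorem bijective_of_triangular {T : R[X] →ₗ[ℂ] R[X]} {u : ℕ → ℂ} (hu : ∀ i, u i ≠ 0)
    (hT : ∀ (i k : ℕ) (f : R), i ≤ k →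
      (T (monomial i f)).coeff k = if k = i then u i • f else 0) : Function.Bijective T := by
  constructor
  · refine (injective_iff_map_eq_zero T).mpr fun p hp => ?_
    by_contra hne
    have e := coeff_map_of_triangular (r := 0) hT p p.natDegree
      fun j hj => coeff_eq_zero_of_natDegree_lt hj
    rw [hp, coeff_zero] at e
    exact hne (leadingCoeff_eq_zero.mp ((smul_eq_zero_iff_right (hu _)).mp e.symm))
  -- Induction on a strict degree bound: subtracting the image of a suitable multiple of X^N removes
  -- the top term.
  · have key : ∀ (N : ℕ) (p : R[X]), (∀ j, N ≤ j → p.coeff j = 0) → ∃ q, T q = p := by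
      intro N
      induction N with
      | zero =>
        intro p hp
        exact ⟨0, by rw [map_zero]; exact (Polynomial.ext fun j => hp j j.zero_le).symm⟩
      | succ N ih =>
        intro p hp
        obtain ⟨q, hq⟩ := ih (p - T (monomial N ((u N)⁻¹ • p.coeff N))) fun j hj => by
          rw [coeff_sub, hT N j _ hj]
          split_ifs with h
          · rw [h, smul_smul, mul_inv_cancel₀ (hu N), one_smul, sub_self]
          · rw [hp j (by omega), sub_zero]
        exact ⟨q + monomial N ((u N)⁻¹ • p.coeff N), by rw [map_add, hq, sub_add_cancel]⟩
    intro p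
    exact key (p.natDegree + 1) p fun j hj => coeff_eq_zero_of_natDegree_lt hj

end Triangular

/-! ### Sums of iterates of an operator -/

section IterSum

variable {M : Type*} [AddCommGroup M] [Module ℂ M]

/-- The linear map sending `∑ i, f i * X ^ i` to `∑ i, T ^ i (g (f i))`. -/
def iterSum (T : Module.End ℂ M) (g : ℂ[X] →ₗ[ℂ] M) : ℂ[X][X] →ₗ[ℂ] M :=
  Polynomial.lsum fun i => (T ^ i) ∘ₗ g

theorem iterSum_monomial (T : Module.End ℂ M) (g : ℂ[X] →ₗ[ℂ] M) (i : ℕ) (f : ℂ[X]) :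
    iterSum T g (monomial i f) = (T ^ i) (g f) := by
  rw [iterSum, Polynomial.lsum_apply, Polynomial.sum_monomial_index]
  · rfl
  · exact map_zero _

end IterSum

/-! ### Freeness of Ω over ℂ[d_m], and its restriction to ℂ[t] -/

section Omega

variable (lam : ℂˣ) (α : ℂ) (h : ℂ[X])

/-- In λ^m (s - m)^i (s f + A_m f) only the factor s f reaches s-degree i + 1, and (s - m)^i is
monic. -/
theorem coeff_omegaD_monomial (m : ℤ) (i k : ℕ) (f : ℂ[X]) (hik : i ≤ k) :
    (omegaD lam α h m (monomial i f)).coeff (k + 1) =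
      if k = i then ((lam ^ m : ℂˣ) : ℂ) • f else 0 := by
  have hd : ((X - C (C (m : ℂ))) ^ i : ℂ[X][X]).natDegree = i := by
    rw [(monic_X_sub_C (C (m : ℂ))).natDegree_pow, natDegree_X_sub_C, mul_one]
  have h1 : ((X - C (C (m : ℂ))) ^ i : ℂ[X][X]).coeff (k + 1) = 0 :=
    coeff_eq_zero_of_natDegree_lt (by rw [hd]; omega)
  rw [← C_mul_X_pow_eq_monomial, omegaD_monomial', coeff_smul, mul_add, ← mul_assoc, coeff_add,
    coeff_mul_C, coeff_mul_C, coeff_mul_X, h1, zero_mul, add_zero]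
  split_ifs with hk
  · have h2 : ((X - C (C (m : ℂ))) ^ i : ℂ[X][X]).coeff i = 1 := by
      have := ((monic_X_sub_C (C (m : ℂ))).pow i).coeff_natDegree
      rwa [hd] at this
    rw [hk, h2, one_mul]
  · rw [coeff_eq_zero_of_natDegree_lt (by rw [hd]; omega), zero_mul, smul_zero]

/-- The inclusion of `ℂ[t]` into `ℂ[t, s]`. -/
def constPoly : ℂ[X] →ₗ[ℂ] ℂ[X][X] := (Polynomial.monomial 0).restrictScalars ℂ

theorem constPoly_apply (f : ℂ[X]) : constPoly f = C f := rfl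

theorem coeff_omegaD_pow (m : ℤ) (i k : ℕ) (f : ℂ[X]) (hik : i ≤ k) :
    ((omegaD lam α h m ^ i) (C f)).coeff k =
      if k = i then (((lam ^ m : ℂˣ) : ℂ) ^ i) • f else 0 := by
  induction i generalizing k with
  | zero => simp [coeff_C]
  | succ i ih =>
    obtain ⟨k, rfl⟩ : ∃ l, k = l + 1 := ⟨k - 1, by omega⟩
    rw [pow_succ', Module.End.mul_apply,
      coeff_map_of_triangular (coeff_omegaD_monomial lam α h m) _ k, ih k (by omega)]
    · by_cases hk : k = i
      · rw [if_pos hk, if_pos (by omega), smul_smul, pow_succ']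
      · rw [if_neg hk, if_neg (by omega), smul_zero]
    · intro j hj
      rw [ih j (by omega), if_neg (by omega)]

/-- `ℂ[t, s]` is free over `ℂ[d m]` on `ℂ[t]`. -/
theorem iterSum_omegaD_bijective (m : ℤ) :
    Function.Bijective (iterSum (omegaD lam α h m) constPoly) := by
  refine bijective_of_triangular (u := fun i => ((lam ^ m : ℂˣ) : ℂ) ^ i)
    (fun i => pow_ne_zero _ (Units.ne_zero _)) fun i k f hik => ?_
  rw [iterSum_monomial, constPoly_apply, coeff_omegaD_pow lam α h m i k f hik]

theorem omegaD_C (m : ℤ) (f : ℂ[X]) : omegaD lam α h m (C f) =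
    ((lam ^ m : ℂˣ) : ℂ) • (X * C f + C (opA α h m f)) := by
  have := omegaD_monomial' lam α h m f 0
  rwa [pow_zero, mul_one, pow_zero, one_mul] at this

/-- The factor λ^(k-n) is chosen so that both terms contribute λ^k s f, which cancels. -/
theorem omegaD_sub_C (n : ℕ) (k : ℤ) (f : ℂ[X]) :
    omegaD lam α h k (C f) - ((lam ^ (k - n) : ℂˣ) : ℂ) • omegaD lam α h n (C f) =
      ((lam ^ k : ℂˣ) : ℂ) • C (opA α h k f - opA α h n f) := by
  have z : ((lam ^ k : ℂˣ) : ℂ) =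
      ((lam ^ (k - n) : ℂˣ) : ℂ) * ((lam ^ (n : ℤ) : ℂˣ) : ℂ) := by
    rw [← Units.val_mul, ← zpow_add]; congr 2; ring
  rw [omegaD_C, omegaD_C, smul_smul, ← z, ← smul_sub, C_sub, add_sub_add_left_eq_sub]

/-- Puts the b-action in the form matching `omegaD_sub_C`: the action on Ω restricted to ℂ[t], plus
the scalar by which the element acts on the generator of V. -/
theorem bFun_bGen_eq (n : ℕ) (a : Fin (n + 1) → ℂ) (k : ℤ) (f : ℂ[X]) :
    bFun lam n α h a (bGen lam n k) f = ((lam ^ k : ℂˣ) : ℂ) • (opA α h k f - opA α h n f)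
      + (aExt n a k - ((lam ^ (k - n) : ℂˣ) : ℂ) * aExt n a n) • f := by
  have z : ((lam ^ k : ℂˣ) : ℂ) =
      ((lam ^ (k - n) : ℂˣ) : ℂ) * ((lam ^ (n : ℤ) : ℂˣ) : ℂ) := by
    rw [← Units.val_mul, ← zpow_add]; congr 2; ring
  simp only [bFun, bGen, map_sub, map_smul, Vir.lift_d, LinearMap.sub_apply, LinearMap.add_apply,
    LinearMap.smul_apply, LinearMap.id_apply, z]
  module

end Omega

/-! ### Universal property of V_{a,θ} -/

theorem WhitMod.lie_eq_smul {n : ℕ} {a : Fin (n + 1) → ℂ} (x : virGE n) (v : WhitMod n a) :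
    ⁅x, v⁆ = whitFun n a x • v := rfl

namespace WhittakerVerma

variable (n : ℕ) (a : Fin (n + 1) → ℂ) (θ : ℂ)

/-- The canonical generator. -/
def gen : WhittakerVerma n a θ := CentralQuotient.of θ (virGE n) (WhitMod n a) (1 : ℂ)

theorem d_lie_gen (k : ℤ) (hk : (n : ℤ) ≤ k) : ⁅Vir.d k, gen n a θ⁆ = aExt n a k • gen n a θ := by
  have hm : Vir.d k ∈ virGE n := Submodule.subset_span ⟨k, hk, rfl⟩
  have e (v : WhitMod n a) : ⁅Vir.d k, CentralQuotient.of θ (virGE n) (WhitMod n a) v⁆ =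
      aExt n a k • CentralQuotient.of θ (virGE n) (WhitMod n a) v := by
    rw [← CentralQuotient.of_lie θ (virGE n) ⟨Vir.d k, hm⟩ v, WhitMod.lie_eq_smul, map_smul,
      whitFun, Vir.lift_d]
  exact e _

variable {n a θ} {P : Type*} [AddCommGroup P] [Module ℂ P] [LieRingModule Vir P] [LieModule ℂ Vir P]

/-- The universal property of `V_{a, θ}`. -/
theorem exists_lift (y : P) (hd : ∀ k : ℤ, (n : ℤ) ≤ k → ⁅Vir.d k, y⁆ = aExt n a k • y)
    (hc : ∀ p : P, ⁅Vir.c, p⁆ = θ • p) :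
    ∃ F : WhittakerVerma n a θ →ₗ⁅ℂ, Vir⁆ P, F (gen n a θ) = y := by
  let g : WhitMod n a →ₗ[ℂ] P := LinearMap.toSpanSingleton ℂ P y
  have key : ∀ x ∈ virGE n, ⁅x, y⁆ = whitFun n a x • y := by
    intro x hx
    change x ∈ Submodule.span ℂ _ at hx
    induction hx using Submodule.span_induction with
    | mem x hx =>
      obtain ⟨k, hk, rfl⟩ := hx
      rw [hd k hk, whitFun, Vir.lift_d]
    | zero => rw [zero_lie, map_zero, zero_smul]
    | add x z _ _ hx hz => rw [add_lie, hx, hz, map_add, add_smul]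
    | smul r x _ hx => rw [smul_lie, hx, map_smul, smul_assoc]
  have hg : ∀ (x : virGE n) (v : WhitMod n a), g ⁅x, v⁆ = ⁅(x : Vir), g v⁆ := by
    intro x v
    change (whitFun n a x * (show ℂ from v)) • y = ⁅(x : Vir), (show ℂ from v) • y⁆
    rw [lie_smul, key x x.2, smul_smul, mul_comm]
  exact ⟨CentralQuotient.indLift g hg hc,
    (CentralQuotient.indLift_of g hg hc _).trans (one_smul ℂ y)⟩

theorem hom_ext {F G : WhittakerVerma n a θ →ₗ⁅ℂ, Vir⁆ P}
    (h : F (gen n a θ) = G (gen n a θ)) : F = G := by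
  refine CentralQuotient.indHom_ext fun v => ?_
  obtain ⟨z, e⟩ : ∃ z : ℂ, CentralQuotient.of θ (virGE n) (WhitMod n a) v = z • gen n a θ :=
    let z : ℂ := v
    ⟨z, (congrArg (CentralQuotient.of θ (virGE n) (WhitMod n a)) (mul_one z).symm).trans
      (map_smul (CentralQuotient.of θ (virGE n) (WhitMod n a)) z _)⟩
  rw [e, map_smul, map_smul, h]

end WhittakerVerma

/-! ### Tensor-hom adjunction for Lie modules -/

section TensorHom

variable {L U V P : Type*} [LieRing L] [LieAlgebra ℂ L] [AddCommGroup U] [Module ℂ U]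
  [LieRingModule L U] [LieModule ℂ L U] [AddCommGroup V] [Module ℂ V]
  [LieRingModule L V] [LieModule ℂ L V] [AddCommGroup P] [Module ℂ P]
  [LieRingModule L P] [LieModule ℂ L P]

/-- The homomorphism `U ⊗ V → P` corresponding to `V → Hom(U, P)`. -/
def lieUncurry (F : V →ₗ⁅ℂ, L⁆ (U →ₗ[ℂ] P)) : U ⊗[ℂ] V →ₗ⁅ℂ, L⁆ P where
  __ := TensorProduct.lift (LinearMap.flip (F : V →ₗ[ℂ] U →ₗ[ℂ] P))
  map_lie' := by
    intro x z
    change TensorProduct.lift (LinearMap.flip (F : V →ₗ[ℂ] U →ₗ[ℂ] P)) ⁅x, z⁆ =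
      ⁅x, TensorProduct.lift (LinearMap.flip (F : V →ₗ[ℂ] U →ₗ[ℂ] P)) z⁆
    induction z with
    | zero => simp
    | add y z hy hz => rw [lie_add, map_add, hy, hz, map_add, lie_add]
    | tmul p v =>
      rw [TensorProduct.LieModule.lie_tmul_right, map_add]
      change F v ⁅x, p⁆ + F ⁅x, v⁆ p = ⁅x, F v p⁆
      rw [LieModuleHom.map_lie, LieHom.lie_apply, add_sub_cancel]

theorem lieUncurry_tmul (F : V →ₗ⁅ℂ, L⁆ (U →ₗ[ℂ] P)) (p : U) (v : V) :
    lieUncurry F (p ⊗ₜ v) = F v p := rfl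

/-- The homomorphism `V → Hom(U, P)` corresponding to `U ⊗ V → P`. -/
def lieCurry (F : U ⊗[ℂ] V →ₗ⁅ℂ, L⁆ P) : V →ₗ⁅ℂ, L⁆ (U →ₗ[ℂ] P) where
  __ := LinearMap.flip (TensorProduct.curry (F : U ⊗[ℂ] V →ₗ[ℂ] P))
  map_lie' := by
    intro x v
    refine LinearMap.ext fun p => ?_
    change F (p ⊗ₜ ⁅x, v⁆) = ⁅x, F (p ⊗ₜ v)⁆ - F (⁅x, p⁆ ⊗ₜ v)
    rw [← LieModuleHom.map_lie, TensorProduct.LieModule.lie_tmul_right, map_add,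
      add_sub_cancel_left]

theorem lieCurry_apply (F : U ⊗[ℂ] V →ₗ⁅ℂ, L⁆ P) (p : U) (v : V) :
    lieCurry F v p = F (p ⊗ₜ v) := rfl

end TensorHom

/-- After currying, a homomorphism out of V is determined by its value at the generator, here a
linear map on U. -/
theorem tensorWhittaker_hom_ext {n : ℕ} {a : Fin (n + 1) → ℂ} {θ : ℂ} {U P : Type*}
    [AddCommGroup U] [Module ℂ U] [LieRingModule Vir U] [LieModule ℂ Vir U]
    [AddCommGroup P] [Module ℂ P] [LieRingModule Vir P] [LieModule ℂ Vir P]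
    {F G : U ⊗[ℂ] WhittakerVerma n a θ →ₗ⁅ℂ, Vir⁆ P}
    (h : ∀ p : U, F (p ⊗ₜ WhittakerVerma.gen n a θ) = G (p ⊗ₜ WhittakerVerma.gen n a θ)) :
    F = G := by
  have e : lieCurry F = lieCurry G := WhittakerVerma.hom_ext (LinearMap.ext h)
  refine LieModuleHom.ext fun z => ?_
  induction z with
  | zero => rw [map_zero, map_zero]
  | add y z hy hz => rw [map_add, map_add, hy, hz]
  | tmul p v => rw [← lieCurry_apply, e, lieCurry_apply]

/-! ### The twisted intertwiner Φ : Ω → Ind -/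

namespace IndTheta

variable (θ : ℂ) (lam : ℂˣ) (n : ℕ) (α : ℂ) (h : ℂ[X]) (a : Fin (n + 1) → ℂ)

/-- The canonical map from `ℂ[t]` to the induced module. -/
def of : ℂ[X] →ₗ[ℂ] IndTheta θ lam n α h a :=
  CentralQuotient.of θ (bSub lam n) (BMod lam n α h a)

theorem d_lie_of (k : ℤ) (hk : (n : ℤ) < k) (f : ℂ[X]) :
    ⁅Vir.d k, of θ lam n α h a f⁆ = ((lam ^ (k - n) : ℂˣ) : ℂ) • ⁅Vir.d n, of θ lam n α h a f⁆
      + of θ lam n α h a (bFun lam n α h a (bGen lam n k) f) := by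
  have e (v : BMod lam n α h a) :=
    CentralQuotient.of_lie θ (bSub lam n) ⟨bGen lam n k, bGen_mem lam n k hk⟩ v
  have e' : of θ lam n α h a (bFun lam n α h a (bGen lam n k) f) =
    ⁅Vir.d k - ((lam ^ (k - n) : ℂˣ) : ℂ) • Vir.d n, of θ lam n α h a f⁆ := e f
  rw [e', sub_lie, smul_lie, add_sub_cancel]

/-- `d n - a_n` acting on the induced module. -/
def shiftedD : Module.End ℂ (IndTheta θ lam n α h a) :=
  LieModule.toEnd ℂ Vir _ (Vir.d n) - aExt n a n • LinearMap.id

theorem shiftedD_apply (m : IndTheta θ lam n α h a) :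
    shiftedD θ lam n α h a m = ⁅Vir.d n, m⁆ - aExt n a n • m := rfl

/-- The map `ℂ[t, s] → Ind` extending the canonical map on `ℂ[t]` and intertwining the action of
`d n` with that of `d n - a_n`. -/
def omegaTo : ℂ[X][X] →ₗ[ℂ] IndTheta θ lam n α h a :=
  iterSum (shiftedD θ lam n α h a) (of θ lam n α h a) ∘ₗ
    (LinearEquiv.ofBijective _ (iterSum_omegaD_bijective lam α h n)).symm.toLinearMap

/-- Working formula for Φ: the sum of d_n^i f_i goes to the sum of (d_n - a_n)^i (1 ⊗ f_i). -/
theorem omegaTo_iterSum (q : ℂ[X][X]) :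
    omegaTo θ lam n α h a (iterSum (omegaD lam α h n) constPoly q) =
      iterSum (shiftedD θ lam n α h a) (of θ lam n α h a) q :=
  congrArg (iterSum (shiftedD θ lam n α h a) (of θ lam n α h a))
    ((LinearEquiv.ofBijective _ (iterSum_omegaD_bijective lam α h n)).symm_apply_apply q)

theorem omegaTo_C (f : ℂ[X]) : omegaTo θ lam n α h a (C f) = of θ lam n α h a f := by
  have := omegaTo_iterSum θ lam n α h a (monomial 0 f)
  rwa [iterSum_monomial, iterSum_monomial] at this

theorem omegaTo_omegaD (p : ℂ[X][X]) : omegaTo θ lam n α h a (omegaD lam α h n p) =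
    shiftedD θ lam n α h a (omegaTo θ lam n α h a p) := by
  obtain ⟨q, rfl⟩ := (iterSum_omegaD_bijective lam α h n).2 p
  induction q using Polynomial.induction_on' with
  | add p q hp hq =>
    simp only [map_add, hp, hq]
  | monomial i f =>
    have e : omegaD lam α h n (iterSum (omegaD lam α h n) constPoly (monomial i f)) =
        iterSum (omegaD lam α h n) constPoly (monomial (i + 1) f) := by
      rw [iterSum_monomial, iterSum_monomial, pow_succ', Module.End.mul_apply]
    rw [e, omegaTo_iterSum, omegaTo_iterSum, iterSum_monomial, iterSum_monomial, pow_succ',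
      Module.End.mul_apply]

/-- On ℂ[t] the operator d_k is λ^(k-n) d_n plus an operator preserving ℂ[t]. The same holds for d_k
in Ind, and the two corrections differ only by the scalars a_k and a_n. -/
theorem omegaTo_omegaD_C (k : ℤ) (hk : (n : ℤ) < k) (f : ℂ[X]) :
    omegaTo θ lam n α h a (omegaD lam α h k (C f)) =
      ⁅Vir.d k, of θ lam n α h a f⁆ - aExt n a k • of θ lam n α h a f := by
  have e := omegaD_sub_C lam α h n k f
  rw [sub_eq_iff_eq_add.mp e, map_add, map_smul, map_smul, omegaTo_omegaD, omegaTo_C, omegaTo_C,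
    d_lie_of θ lam n α h a k hk, bFun_bGen_eq, shiftedD_apply]
  simp only [map_add, map_smul]
  module

/-- This is the condition that Φ, as a vector of Hom(Ω, Ind), satisfies d_k Φ = a_k Φ. -/
theorem omegaTo_omegaD_of_le (k : ℤ) (hk : (n : ℤ) ≤ k) (p : ℂ[X][X]) :
    omegaTo θ lam n α h a (omegaD lam α h k p) =
      ⁅Vir.d k, omegaTo θ lam n α h a p⁆ - aExt n a k • omegaTo θ lam n α h a p := by
  obtain ⟨q, rfl⟩ := (iterSum_omegaD_bijective lam α h n).2 p
  induction q using Polynomial.induction_on' with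
  | add p q hp hq =>
    simp only [map_add, hp, hq, lie_add, smul_add]
    abel
  | monomial i f =>
    rw [iterSum_monomial, constPoly_apply]
    -- The index `k` must vary: commuting d_k past d_n calls for the hypothesis at `k + n`.
    induction i generalizing k with
    | zero =>
      rcases hk.eq_or_lt with rfl | hk
      · exact omegaTo_omegaD θ lam n α h a _
      · have := omegaTo_omegaD_C θ lam n α h a k hk f
        rw [← omegaTo_C] at this
        exact this
    | succ i ih =>
      rcases hk.eq_or_lt with rfl | hk
      · exact omegaTo_omegaD θ lam n α h a _
      rw [pow_succ', Module.End.mul_apply]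
      set p := (omegaD lam α h n ^ i) (C f) with hp
      have hcomm : omegaD lam α h k (omegaD lam α h n p) =
          omegaD lam α h n (omegaD lam α h k p) + ((n : ℂ) - k) • omegaD lam α h (k + n) p := by
        have := congrArg (fun T => T p) (omegaD_comm lam α h k n)
        simp only [LinearMap.sub_apply, Module.End.mul_apply, LinearMap.smul_apply] at this
        rw [← sub_eq_iff_eq_add', this]
        push_cast
        rfl
      -- From k > n follows k + n > 2n, so a_(k+n) = 0; hence d_k - a_k and d_n - a_n satisfy the
      -- same commutator relation as d_k and d_n.
      rw [hcomm, map_add, map_smul, omegaTo_omegaD, ih k hk.le, ih (k + n) (by omega), omegaTo_omegaD,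
        aExt_of_gt n a (k + n) (by omega), shiftedD_apply, shiftedD_apply]
      generalize omegaTo θ lam n α h a p = m
      have hl : ⁅Vir.d k, ⁅Vir.d n, m⁆⁆ =
          ((n : ℂ) - k) • ⁅Vir.d (k + n), m⁆ + ⁅Vir.d n, ⁅Vir.d k, m⁆⁆ := by
        rw [leibniz_lie, Vir.lie_d_d, if_neg (by omega), zero_smul, add_zero, smul_lie]
        push_cast
        rfl
      simp only [lie_sub, lie_smul, hl]
      module

end IndTheta

/-! ### The two mutually inverse homomorphisms -/

section Isomorphism

variable (n : ℕ) (a : Fin (n + 1) → ℂ) (θ : ℂ) (lam : ℂˣ) (α : ℂ) (h : ℂ[X])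

/-- The map `p ↦ p ⊗ 1` from `ℂ[t, s]` to `Ω(λ, α, h) ⊗ V_{a, θ}`. -/
def tmulGen : ℂ[X][X] →ₗ[ℂ] Omega lam α h ⊗[ℂ] WhittakerVerma n a θ :=
  (TensorProduct.mk ℂ (Omega lam α h) (WhittakerVerma n a θ)).flip (WhittakerVerma.gen n a θ)

theorem d_lie_tmulGen (k : ℤ) (hk : (n : ℤ) ≤ k) (p : ℂ[X][X]) :
    ⁅Vir.d k, tmulGen n a θ lam α h p⁆ =
      tmulGen n a θ lam α h (omegaD lam α h k p) + aExt n a k • tmulGen n a θ lam α h p := by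
  have e (p : Omega lam α h) : ⁅Vir.d k, p ⊗ₜ[ℂ] WhittakerVerma.gen n a θ⁆ =
      tmulGen n a θ lam α h (omegaD lam α h k p)
        + aExt n a k • (p ⊗ₜ[ℂ] WhittakerVerma.gen n a θ) := by
    rw [TensorProduct.LieModule.lie_tmul_right, WhittakerVerma.d_lie_gen n a θ k hk,
      TensorProduct.tmul_smul, Omega.d_lie]
    rfl
  exact e p

theorem c_lie_omega_tensor (z : Omega lam α h ⊗[ℂ] WhittakerVerma n a θ) :
    ⁅Vir.c, z⁆ = θ • z := by
  induction z with
  | zero => rw [lie_zero, smul_zero]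
  | add y z hy hz => rw [lie_add, hy, hz, smul_add]
  | tmul p v =>
    rw [TensorProduct.LieModule.lie_tmul_right, Omega.c_lie, CentralQuotient.c_lie,
      TensorProduct.zero_tmul, zero_add, TensorProduct.tmul_smul]

/-- The equivariance that makes f ↦ f ⊗ w extend to Ind; by linearity in `x` it is checked on d_k -
λ^(k-n) d_n. -/
theorem tmulGen_C_bFun (x : Vir) (hx : x ∈ bSub lam n) (f : ℂ[X]) :
    tmulGen n a θ lam α h (constPoly (bFun lam n α h a x f)) =
      ⁅x, tmulGen n a θ lam α h (constPoly f)⁆ := by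
  change x ∈ Submodule.span ℂ _ at hx
  induction hx using Submodule.span_induction with
  | zero => rw [map_zero, LinearMap.zero_apply, map_zero, map_zero, zero_lie]
  | add x z _ _ hx hz => rw [map_add, LinearMap.add_apply, map_add, map_add, hx, hz, add_lie]
  | smul r x _ hx => rw [map_smul, LinearMap.smul_apply, map_smul, map_smul, hx, smul_lie]
  | mem x hx =>
    obtain ⟨k, hk, rfl⟩ := hx
    have e := congrArg (tmulGen n a θ lam α h) (omegaD_sub_C lam α h n k f)
    rw [map_sub, map_smul, map_smul] at e
    rw [bFun_bGen_eq, map_add, map_add, map_smul, map_smul, map_smul, map_smul, constPoly_apply,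
      constPoly_apply, ← e, bGen, sub_lie, smul_lie, d_lie_tmulGen n a θ lam α h k (by omega),
      d_lie_tmulGen n a θ lam α h n le_rfl]
    module

/-- The homomorphism `Ind → Ω ⊗ V` with `f ↦ f ⊗ 1` on `ℂ[t]`. -/
def fromInd : IndTheta θ lam n α h a →ₗ⁅ℂ, Vir⁆ Omega lam α h ⊗[ℂ] WhittakerVerma n a θ :=
  CentralQuotient.indLift (N := BMod lam n α h a) (tmulGen n a θ lam α h ∘ₗ constPoly)
    (fun x f => tmulGen_C_bFun n a θ lam α h x x.2 f) (c_lie_omega_tensor n a θ lam α h)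

theorem fromInd_of (f : ℂ[X]) : fromInd n a θ lam α h (IndTheta.of θ lam n α h a f) =
    tmulGen n a θ lam α h (C f) :=
  CentralQuotient.indLift_of (N := BMod lam n α h a) (tmulGen n a θ lam α h ∘ₗ constPoly) _ _ f

/-- Both sides agree on ℂ[t] and turn d_n on Ω into d_n - a_n on the target, so freeness over ℂ[d_n]
forces equality. -/
theorem fromInd_omegaTo (p : ℂ[X][X]) :
    fromInd n a θ lam α h (IndTheta.omegaTo θ lam n α h a p) = tmulGen n a θ lam α h p := by
  obtain ⟨q, rfl⟩ := (iterSum_omegaD_bijective lam α h n).2 p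
  rw [IndTheta.omegaTo_iterSum]
  induction q using Polynomial.induction_on' with
  | add p q hp hq => simp only [map_add, hp, hq]
  | monomial i f =>
    rw [iterSum_monomial, iterSum_monomial, constPoly_apply]
    induction i with
    | zero => exact fromInd_of n a θ lam α h f
    | succ i ih =>
      rw [pow_succ', pow_succ', Module.End.mul_apply, Module.End.mul_apply,
        IndTheta.shiftedD_apply, map_sub, LieModuleHom.map_lie, map_smul, ih,
        d_lie_tmulGen n a θ lam α h n le_rfl, add_sub_cancel_right]

theorem exists_toInd : ∃ F : Omega lam α h ⊗[ℂ] WhittakerVerma n a θ →ₗ⁅ℂ, Vir⁆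
    IndTheta θ lam n α h a,
    ∀ p : Omega lam α h, F (p ⊗ₜ WhittakerVerma.gen n a θ) = IndTheta.omegaTo θ lam n α h a p := by
  -- Φ is viewed as a vector of the Virasoro module Hom(Ω, Ind), where (x · g)(p) = x · g(p) - g(x ·
  -- p). There c acts by θ because it kills Ω.
  let y : Omega lam α h →ₗ[ℂ] IndTheta θ lam n α h a := IndTheta.omegaTo θ lam n α h a
  obtain ⟨F, hF⟩ := WhittakerVerma.exists_lift (n := n) (a := a) (θ := θ) y
    (fun k hk => LinearMap.ext fun p => by
      rw [LieHom.lie_apply, Omega.d_lie, LinearMap.smul_apply]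
      exact (congrArg _ (IndTheta.omegaTo_omegaD_of_le θ lam n α h a k hk p)).trans
        (sub_sub_cancel _ _))
    (fun g => LinearMap.ext fun p => by
      rw [LieHom.lie_apply, Omega.c_lie, map_zero, sub_zero, CentralQuotient.c_lie,
        LinearMap.smul_apply])
  exact ⟨lieUncurry F, fun p => by rw [lieUncurry_tmul, hF]; rfl⟩

end Isomorphism

end

/-- For `Ω(λ, α, h)` and a Whittaker or Verma module `V_{a, θ}`, the tensor product
`Ω(λ, α, h) ⊗ V_{a, θ}` is isomorphic, as a Virasoro module, to the induced module
`Ind_{θ, λ}(ℂ[t]_{α, h, a})`. -/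
theorem theorem5p2 (n : ℕ) (a : Fin (n + 1) → ℂ) (θ : ℂ) (lam : ℂˣ) (α : ℂ) (h : ℂ[X]) :
    Nonempty ((Omega lam α h ⊗[ℂ] WhittakerVerma n a θ) ≃ₗ⁅ℂ, Vir⁆ IndTheta θ lam n α h a) := by
  obtain ⟨F, hF⟩ := exists_toInd n a θ lam α h
  -- Each composite is compared with the identity on generators only: Ω ⊗ w here, the image of ℂ[t]
  -- for the other.
  have h1 : (fromInd n a θ lam α h).comp F = LieModuleHom.id :=
    tensorWhittaker_hom_ext fun p =>
      (congrArg (fromInd n a θ lam α h) (hF p)).trans (fromInd_omegaTo n a θ lam α h p)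
  have h2 : F.comp (fromInd n a θ lam α h) = LieModuleHom.id :=
    CentralQuotient.indHom_ext fun f =>
      (congrArg F (fromInd_of n a θ lam α h f)).trans
        ((hF _).trans (IndTheta.omegaTo_C θ lam n α h a f))
  exact ⟨{ F with
    invFun := fromInd n a θ lam α h
    left_inv := fun z => congrArg (fun G => G z) h1
    right_inv := fun m => congrArg (fun G => G m) h2 }⟩
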